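/- Let $\mathbb{C}$ be the category generated by the following graph and relations. Its vertices are $\star$; $[n]$ for $n\in\mathbb{N}$; the basic moves $\heartsuit_n$ (tick), $\pi^l_n,\pi^r_n$ (left and right half-forking), $\nu_n$ (channel creation), and $\iota^+_{n,i},\iota^-_{n,i}$ (output and input) for $1\le i\le n$; $\pi_n$ (forking); and $\tau_{n,i,m,j}$ (synchronisation) for $1\le i\le n$, $1\le j\le m$. Its edges are $d_i\colon\star\to[n]$ for $1\le i\le n$; $s\colon[n]\to M$ and $t\colon[\mathrm{cod}(M)]\to M$ for each basic move $M$ with index $n$, where $\mathrm{cod}(\nu_n)=n+1$ and $\mathrm{cod}(M)=n$ otherwise; $l\colon\pi^l_n\to\pi_n$ and $r\colon\pi^r_n\to\pi_n$; $\epsilon\colon\iota^+_{n,i}\to\tau_{n,i,m,j}$ and $\rho\colon\iota^-_{m,j}\to\tau_{n,i,m,j}$. The relations are $s d_i=t d_i$ for each basic move with index $n$ and $1\le i\le n$, $ls=rs$, and $\epsilon s d_i=\rho s d_j$. Write $\widehat{\mathbb{C}}=[\mathbb{C}^{op},\mathrm{Set}]$ and identify vertices with representable presheaves. A basic move $M$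 with index $n$ is regarded as the cospan $[n]\xrightarrow{s}M\xleftarrow{t}[\mathrm{cod}(M)]$ in $\widehat{\mathbb{C}}$; let $\mathcal{M}_n$ be the (finite) set of basic moves with index $n$ (no two of them are isomorphic as cospans). A view is a morphism of $\widehat{\mathbb{C}}$ isomorphic to the initial leg $[n]\to V$ of a finite, possibly empty, composite of basic moves, composition being that of cospans (by pushout). Let $\mathbb{V}_n$ be the category whose objects are views $Y\to U$ equipped with a morphism $Y\to[n]$, and whose morphisms are commuting squares compatible with the morphisms to $[n]$; it is essentially small, and is replaced by an equivalent small full subcategory. Each $M\in\mathcal{M}_n$ induces a functor $(-\circ M)\colon\mathbb{V}_{\mathrm{cod}(M)}\to\mathbb{V}_n$, sending $[\mathrm{cod}(M)]\to V$ to $[n]\to M\to M+_{[\mathrm{cod}(M)]}V$. For every view $V$ on $[n]$ there is an inclusion $\mathrm{id}_{[n]}\to V$ in $\mathbb{V}_n$. Let $\mathrm{FinOrd}$ be the category of finite ordinals and monotone maps, $\mathrm{FinOrd}_0=\mathbb{N}$ its set of objects, and $\mathrm{OPsh}(\mathbb{V}_n)=[\mathbb{V}_n^{op},\mathrm{FinOrd}]$.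 Let $F$ be the (polynomial) endofunctor on $\mathrm{Set}/\mathrm{FinOrd}_0$, i.e. on families of sets $X=(X_n)_{n\in\mathbb{N}}$, given by $$(F X)_n=\sum_{I\in\mathrm{FinOrd}_0}\Bigl(\prod_{M\in\mathcal{M}_n}X_{\mathrm{cod}(M)}\Bigr)^I .$$ For $S\in\mathrm{ob}(\mathrm{OPsh}(\mathbb{V}_n))$ and $i\in S(\mathrm{id}_{[n]})$, let $S|_i\in\mathrm{ob}(\mathrm{OPsh}(\mathbb{V}_n))$ send each $V$ to the fibre over $i$ of $S(V)\to S(\mathrm{id}_{[n]})$, with its induced order. **Theorem.** The family $\bigl(\mathrm{ob}(\mathrm{OPsh}(\mathbb{V}_n))\bigr)_{n\in\mathbb{N}}$, equipped with the structure map $$S\;\longmapsto\;\Bigl(S(\mathrm{id}_{[n]}),\ \bigl(i\mapsto (M\mapsto S|_i(-\circ M))\bigr)\Bigr),$$ is a terminal $F$-coalgebra: for every $F$-coalgebra $a\colon X\to F X$ there is exactly one morphism of $F$-coalgebras from $(X,a)$ to it. -/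

import Mathlib

open CategoryTheory CategoryTheory.Limits

namespace CCSGame

/-! ## The base category -/

/-- Basic moves available to a player knowing `n` channels: tick, left and right half-forking,
channel creation, output and input on the `i`-th channel. -/
inductive BasicMove : ℕ → Type
  | tick (n : ℕ) : BasicMove n
  | forkL (n : ℕ) : BasicMove n
  | forkR (n : ℕ) : BasicMove n
  | nu (n : ℕ) : BasicMove n
  | out (n : ℕ) (i : Fin n) : BasicMove n
  | inp (n : ℕ) (i : Fin n) : BasicMove n

/-- Number of channels known to the player after the move: channel creation adds one channel,
all other basic moves leave the channels unchanged. -/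
def BasicMove.cod : {n : ℕ} → BasicMove n → ℕ
  | _, .tick n => n
  | _, .forkL n => n
  | _, .forkR n => n
  | _, .nu n => n + 1
  | _, .out n _ => n
  | _, .inp n _ => n

theorem BasicMove.le_cod : {n : ℕ} → (M : BasicMove n) → n ≤ M.cod
  | _, .tick n => le_refl n
  | _, .forkL n => le_refl n
  | _, .forkR n => le_refl n
  | _, .nu n => Nat.le_succ n
  | _, .out n _ => le_refl n
  | _, .inp n _ => le_refl n

/-- Vertices of the generating graph: the channel vertex `⋆`, the players `[n]`, the basic moves,
the full forking moves and the synchronisation moves. -/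
inductive Vertex : Type
  | star : Vertex
  | player (n : ℕ) : Vertex
  | basic {n : ℕ} (M : BasicMove n) : Vertex
  | fork (n : ℕ) : Vertex
  | sync (n : ℕ) (i : Fin n) (m : ℕ) (j : Fin m) : Vertex

/-- Edges of the generating graph. -/
inductive Edge : Vertex → Vertex → Type
  | d (n : ℕ) (i : Fin n) : Edge .star (.player n)
  | s {n : ℕ} (M : BasicMove n) : Edge (.player n) (.basic M)
  | t {n : ℕ} (M : BasicMove n) : Edge (.player M.cod) (.basic M)
  | l (n : ℕ) : Edge (.basic (.forkL n)) (.fork n)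
  | r (n : ℕ) : Edge (.basic (.forkR n)) (.fork n)
  | ε (n : ℕ) (i : Fin n) (m : ℕ) (j : Fin m) : Edge (.basic (.out n i)) (.sync n i m j)
  | ρ (n : ℕ) (i : Fin n) (m : ℕ) (j : Fin m) : Edge (.basic (.inp m j)) (.sync n i m j)

instance : Quiver Vertex := ⟨Edge⟩

/-- An edge of the generating graph, as a morphism of the free category. -/
def free {a b : Vertex} (e : Edge a b) : (Paths.of Vertex).obj a ⟶ (Paths.of Vertex).obj b :=
  (Paths.of Vertex).map e

/-- The relations imposed on the free category. -/
inductive Rel : HomRel (Paths Vertex)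
  /-- `s ∘ dᵢ = t ∘ dᵢ`: the channels known before a basic move remain the same. -/
  | channel {n : ℕ} (M : BasicMove n) (i : Fin n) :
      Rel (free (.d n i) ≫ free (.s M)) (free (.d M.cod (i.castLE M.le_cod)) ≫ free (.t M))
  /-- `l ∘ s = r ∘ s`: both halves of a forking move are played by the same player. -/
  | fork (n : ℕ) :
      Rel (free (.s (.forkL n)) ≫ free (.l n)) (free (.s (.forkR n)) ≫ free (.r n))
  /-- `ε ∘ s ∘ dᵢ = ρ ∘ s ∘ dⱼ`: output and input take place on the same channel. -/
  | sync (n : ℕ) (i : Fin n) (m : ℕ) (j : Fin m) :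
      Rel (free (.d n i) ≫ free (.s (.out n i)) ≫ free (.ε n i m j))
        (free (.d m j) ≫ free (.s (.inp m j)) ≫ free (.ρ n i m j))

/-- The base category `ℂ`: generated by the graph above, subject to the relations above. -/
abbrev Base : Type := CategoryTheory.Quotient Rel

/-- A vertex, as an object of the base category. -/
abbrev Vertex.toBase (v : Vertex) : Base := ⟨(Paths.of Vertex).obj v⟩

/-- An edge, as a morphism of the base category. -/
def Edge.toBase {a b : Vertex} (e : Edge a b) : a.toBase ⟶ b.toBase :=
  (CategoryTheory.Quotient.functor Rel).map (free e)

/-- Diagrams: presheaves on the base category. -/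
abbrev Diagram : Type 1 := Baseᵒᵖ ⥤ Type

/-- The representable diagram on a vertex. -/
noncomputable abbrev Vertex.diag (v : Vertex) : Diagram := yoneda.obj v.toBase

/-- The position `[n]`, consisting of one player knowing `n` channels. -/
noncomputable abbrev pos (n : ℕ) : Diagram := (Vertex.player n).diag

/-! ## Basic moves as cospans, and views

A basic move `M` is the cospan `[n] ⟶ M ⟵ [M.cod]` of diagrams with the following two legs. -/

/-- Initial leg of a basic move. -/
noncomputable def BasicMove.src {n : ℕ} (M : BasicMove n) : pos n ⟶ (Vertex.basic M).diag :=
  yoneda.map (Edge.s M).toBase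

/-- Final leg of a basic move. -/
noncomputable def BasicMove.tgt {n : ℕ} (M : BasicMove n) : pos M.cod ⟶ (Vertex.basic M).diag :=
  yoneda.map (Edge.t M).toBase

/-- Finite sequences of composable basic moves starting from `[n]`. -/
inductive MoveSeq : ℕ → Type
  | nil (n : ℕ) : MoveSeq n
  | cons {n : ℕ} (M : BasicMove n) (w : MoveSeq M.cod) : MoveSeq n

/-- The composite, in the bicategory of cospans of diagrams, of a sequence of basic moves,
remembering only its initial leg: `nil` is sent to the identity `[n] ⟶ [n]`, and `cons M w` to the
composite `[n] ⟶ M ⟶ M +_{[M.cod]} V` where `[M.cod] ⟶ V` is the composite of `w`. -/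
noncomputable def MoveSeq.comp : {n : ℕ} → MoveSeq n → Under (pos n)
  | _, .nil n => Under.mk (𝟙 (pos n))
  | _, .cons M w => Under.mk (M.src ≫ pushout.inl M.tgt (MoveSeq.comp w).hom)

/-- The diagram underlying the composite of a sequence of basic moves. -/
noncomputable abbrev MoveSeq.diag {n : ℕ} (w : MoveSeq n) : Diagram := w.comp.right

/-- The inclusion of the initial position into the composite of a sequence of basic moves. -/
noncomputable abbrev MoveSeq.incl {n : ℕ} (w : MoveSeq n) : pos n ⟶ w.diag := w.comp.hom

/-- A view is a morphism of diagrams that is isomorphic to the initial leg of a finite, possibly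
empty, composite of basic moves. -/
def IsView (f : Arrow Diagram) : Prop :=
  ∃ (n : ℕ) (w : MoveSeq n), Nonempty (f ≅ Arrow.mk w.incl)

/-- The category `𝕍_X` of views on `X`: objects are views `Y ⟶ U` equipped with a morphism
`Y ⟶ X`; morphisms are commuting squares compatible with the morphisms to `X`. -/
abbrev Views (X : Diagram) : Type 1 :=
  ObjectProperty.FullSubcategory
    (fun A : CostructuredArrow (Arrow.leftFunc (C := Diagram)) X => IsView A.left)

/-- The composite of a sequence of basic moves from `[n]`, as a view on `[n]`. -/
noncomputable def MoveSeq.view {n : ℕ} (w : MoveSeq n) : Views (pos n) where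
  obj := CostructuredArrow.mk (S := Arrow.leftFunc) (Y := Arrow.mk w.incl) (𝟙 (pos n))
  property := ⟨n, w, ⟨Iso.refl _⟩⟩

/-- The category `𝕍_n`: a small version of `𝕍_[n]`, namely its full subcategory on a chosen
composite for every finite sequence of basic moves. -/
abbrev View (n : ℕ) : Type := InducedCategory (Views (pos n)) (MoveSeq.view (n := n))

/-! ### The small version of the category of views is equivalent to the large one -/

/-- Dimension of a vertex. -/
def Vertex.dim : Vertex → ℕ
  | .star => 0
  | .player _ => 1
  | .basic _ => 2
  | .fork _ => 3
  | .sync _ _ _ _ => 3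

theorem Edge.dim_lt {a b : Vertex} (e : Edge a b) : a.dim < b.dim := by
  cases e <;> simp [Vertex.dim]

theorem path_dim {a b : Vertex} (p : Quiver.Path a b) :
    a.dim < b.dim ∨ ∃ h : a = b, p = h ▸ Quiver.Path.nil := by
  induction p with
  | nil => exact Or.inr ⟨rfl, rfl⟩
  | cons q e ih =>
    left
    have he := Edge.dim_lt e
    rcases ih with h | ⟨h, -⟩
    · exact h.trans he
    · subst h; exact he

theorem dim_le {a b : Vertex} (f : a.toBase ⟶ b.toBase) : a.dim ≤ b.dim := by
  obtain ⟨p, -⟩ := (CategoryTheory.Quotient.functor Rel).map_surjective f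
  rcases path_dim p with h | ⟨h, -⟩
  · exact h.le
  · subst h; exact le_rfl

theorem eq_of_dim_eq {a b : Vertex} (f : a.toBase ⟶ b.toBase) (h : a.dim = b.dim) :
    ∃ e : a = b, f = eqToHom (congrArg Vertex.toBase e) := by
  obtain ⟨p, rfl⟩ := (CategoryTheory.Quotient.functor Rel).map_surjective f
  change Quiver.Path a b at p
  rcases path_dim p with h' | ⟨e, hp⟩
  · exact absurd h h'.ne
  · subst e
    subst hp
    exact ⟨rfl, (CategoryTheory.Quotient.functor Rel).map_id _⟩

/-- Distinct basic moves are non-isomorphic as cospans of diagrams, so that `BasicMove n` contains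
exactly one representative of each isomorphism class of basic moves from `[n]`. -/
theorem BasicMove.eq_of_cospan_iso {n : ℕ} (M M' : BasicMove n)
    (e : cospan M.src M.tgt ≅ cospan M'.src M'.tgt) : M = M' := by
  have f : (Vertex.basic M).toBase ⟶ (Vertex.basic M').toBase :=
    yoneda.preimage (e.hom.app WalkingCospan.one)
  obtain ⟨h, -⟩ := eq_of_dim_eq f rfl
  simpa using h

instance (n : ℕ) :
    (inducedFunctor (MoveSeq.view (n := n)) : View n ⥤ Views (pos n)).EssSurj where
  mem_essImage A := by
    obtain ⟨m, w, ⟨e⟩⟩ := A.property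
    obtain ⟨h, hf⟩ := eq_of_dim_eq
      (yoneda.preimage ((Arrow.leftFunc.mapIso e).inv ≫ A.obj.hom : pos m ⟶ pos n)) rfl
    obtain rfl : m = n := by simpa using h
    have hl : (Arrow.leftFunc.mapIso e).inv ≫ A.obj.hom = 𝟙 (pos m) := by
      have := congrArg yoneda.map hf
      rw [yoneda.map_preimage] at this
      exact this.trans (yoneda.map_id _)
    refine ⟨w, ⟨ObjectProperty.isoMk _ (CostructuredArrow.isoMk e.symm ?_)⟩⟩
    exact hl

/-- The category `𝕍_n` is equivalent to the category `𝕍_[n]`. -/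
instance View.isEquivalence (n : ℕ) :
    (inducedFunctor (MoveSeq.view (n := n)) : View n ⥤ Views (pos n)).IsEquivalence where

/-! ## Precomposition of views with a basic move -/

/-- The morphism of diagrams underlying a morphism of views. -/
noncomputable def View.diagMap {n : ℕ} {w w' : View n} (f : w ⟶ w') :
    MoveSeq.diag w ⟶ MoveSeq.diag w' :=
  f.hom.hom.left.right

theorem View.incl_diagMap {n : ℕ} {w w' : View n} (f : w ⟶ w') :
    MoveSeq.incl w ≫ View.diagMap f = MoveSeq.incl w' := by
  have h₁ := f.hom.hom.left.w
  have h₂ : f.hom.hom.left.left ≫ 𝟙 (pos n) = 𝟙 (pos n) := CostructuredArrow.w f.hom.hom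
  have h₃ : f.hom.hom.left.left = 𝟙 (pos n) := (Category.comp_id _).symm.trans h₂
  have h₄ : f.hom.hom.left.left ≫ MoveSeq.incl w' = MoveSeq.incl w ≫ View.diagMap f := h₁
  rw [← h₄, h₃]
  exact Category.id_comp _

/-- A morphism of diagrams under `[n]` is a morphism of views on `[n]`. -/
noncomputable def View.homMk {n : ℕ} {w w' : View n} (k : MoveSeq.diag w ⟶ MoveSeq.diag w')
    (h : MoveSeq.incl w ≫ k = MoveSeq.incl w') : w ⟶ w' :=
  InducedCategory.homMk (ObjectProperty.homMk (CostructuredArrow.homMk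
    (Arrow.homMk (𝟙 (pos n)) k ((Category.id_comp _).trans h.symm)) (Category.id_comp _)))

theorem View.hom_ext {n : ℕ} {w w' : View n} {f g : w ⟶ w'}
    (h : View.diagMap f = View.diagMap g) : f = g := by
  have key : ∀ f : w ⟶ w', f.hom.hom.left.left = 𝟙 (pos n) := fun f => by
    have h₂ : f.hom.hom.left.left ≫ 𝟙 (pos n) = 𝟙 (pos n) := CostructuredArrow.w f.hom.hom
    exact (Category.comp_id _).symm.trans h₂
  apply InducedCategory.hom_ext
  apply ObjectProperty.hom_ext
  apply CostructuredArrow.hom_ext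
  exact Arrow.hom_ext _ _ ((key f).trans (key g).symm) h

@[simp] theorem View.diagMap_homMk {n : ℕ} {w w' : View n}
    (k : MoveSeq.diag w ⟶ MoveSeq.diag w') (h : MoveSeq.incl w ≫ k = MoveSeq.incl w') :
    View.diagMap (View.homMk k h) = k := rfl

@[simp] theorem View.diagMap_id {n : ℕ} (w : View n) : View.diagMap (𝟙 w) = 𝟙 _ := rfl

@[simp] theorem View.diagMap_comp {n : ℕ} {w w' w'' : View n} (f : w ⟶ w') (g : w' ⟶ w'') :
    View.diagMap (f ≫ g) = View.diagMap f ≫ View.diagMap g := rfl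

/-- The identity view on `[n]`. -/
def View.idView (n : ℕ) : View n := MoveSeq.nil n

/-- The inclusion of the identity view into a view. -/
noncomputable def View.fromId {n : ℕ} (w : View n) : View.idView n ⟶ w :=
  View.homMk (w := View.idView n) (MoveSeq.incl w) (Category.id_comp _)

theorem View.fromId_comp {n : ℕ} {w w' : View n} (f : w ⟶ w') :
    View.fromId w ≫ f = View.fromId w' :=
  View.hom_ext (View.incl_diagMap f)

/-- The diagram underlying the composite of a view with a basic move `M`. -/
noncomputable abbrev BasicMove.glue {n : ℕ} (M : BasicMove n) (w : View M.cod) : Diagram :=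
  pushout M.tgt (MoveSeq.incl w)

/-- The action of precomposition with a basic move on morphisms of views, given by the universal
property of the pushout. -/
noncomputable def BasicMove.glueMap {n : ℕ} (M : BasicMove n) {w w' : View M.cod} (f : w ⟶ w') :
    M.glue w ⟶ M.glue w' :=
  pushout.desc (pushout.inl M.tgt (MoveSeq.incl w'))
    (View.diagMap f ≫ pushout.inr M.tgt (MoveSeq.incl w'))
    (pushout.condition.trans ((congrArg (· ≫ pushout.inr M.tgt (MoveSeq.incl w'))
      (View.incl_diagMap f).symm).trans (Category.assoc _ _ _)))

theorem BasicMove.inl_glueMap {n : ℕ} (M : BasicMove n) {w w' : View M.cod} (f : w ⟶ w') :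
    pushout.inl M.tgt (MoveSeq.incl w) ≫ M.glueMap f = pushout.inl M.tgt (MoveSeq.incl w') :=
  pushout.inl_desc _ _ _

theorem BasicMove.inr_glueMap {n : ℕ} (M : BasicMove n) {w w' : View M.cod} (f : w ⟶ w') :
    pushout.inr M.tgt (MoveSeq.incl w) ≫ M.glueMap f =
      View.diagMap f ≫ pushout.inr M.tgt (MoveSeq.incl w') :=
  pushout.inr_desc _ _ _

theorem BasicMove.glueMap_id {n : ℕ} (M : BasicMove n) (w : View M.cod) :
    M.glueMap (𝟙 w) = 𝟙 _ := by
  apply pushout.hom_ext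
  · rw [M.inl_glueMap, Category.comp_id]
  · rw [M.inr_glueMap, View.diagMap_id, Category.comp_id, Category.id_comp]

theorem BasicMove.glueMap_comp {n : ℕ} (M : BasicMove n) {w w' w'' : View M.cod}
    (f : w ⟶ w') (g : w' ⟶ w'') : M.glueMap (f ≫ g) = M.glueMap f ≫ M.glueMap g := by
  apply pushout.hom_ext
  · rw [← Category.assoc, M.inl_glueMap, M.inl_glueMap, M.inl_glueMap]
  · rw [← Category.assoc, M.inr_glueMap, M.inr_glueMap, Category.assoc, M.inr_glueMap,
      View.diagMap_comp, Category.assoc]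

/-- The functor `- ∘ M : 𝕍_{cod M} ⥤ 𝕍_n` precomposing views with a basic move `M`, in the
bicategory of cospans of diagrams. -/
noncomputable def BasicMove.precomp {n : ℕ} (M : BasicMove n) : View M.cod ⥤ View n where
  obj w := MoveSeq.cons M w
  map {w w'} f := View.homMk (w := MoveSeq.cons M w) (w' := MoveSeq.cons M w') (M.glueMap f)
    ((Category.assoc _ _ _).trans (congrArg (M.src ≫ ·) (M.inl_glueMap f)))
  map_id w := View.hom_ext (M.glueMap_id w)
  map_comp f g := View.hom_ext (M.glueMap_comp f g)

/-! ## Presheaves of finite ordinals -/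

/-- Finite ordinals: `⟨k⟩` is the ordinal `{0 < ⋯ < k - 1}`. -/
structure FinOrd : Type where
  /-- The number of elements. -/
  card : ℕ

/-- The category of finite ordinals and monotone maps. -/
instance : Category FinOrd where
  Hom a b := Fin a.card →o Fin b.card
  id _ := OrderHom.id
  comp f g := OrderHom.comp g f

/-- The monotone map underlying a morphism of finite ordinals. -/
def FinOrd.toFun {a b : FinOrd} (f : a ⟶ b) : Fin a.card →o Fin b.card := f

/-- The category of presheaves of finite ordinals. -/
abbrev OPsh (K : Type) [Category.{0} K] : Type := Kᵒᵖ ⥤ FinOrd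

/-- The fibre of a monotone map over a point, as a finite ordinal. -/
def FinOrd.fibre {a b : FinOrd} (f : a ⟶ b) (i : Fin b.card) : FinOrd :=
  ⟨Fintype.card {x : Fin a.card // FinOrd.toFun f x = i}⟩

/-- The elements of the fibre ordinal are, in order, the elements of the fibre. -/
def FinOrd.fibreIso {a b : FinOrd} (f : a ⟶ b) (i : Fin b.card) :
    Fin (FinOrd.fibre f i).card ≃o {x : Fin a.card // FinOrd.toFun f x = i} :=
  monoEquivOfFin _ rfl

/-- A monotone map over `b` restricts to fibres. -/
def FinOrd.fibreMap {a a' b : FinOrd} (g : a ⟶ a') (f : a ⟶ b) (f' : a' ⟶ b) (h : g ≫ f' = f)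
    (i : Fin b.card) : FinOrd.fibre f i ⟶ FinOrd.fibre f' i where
  toFun x := (FinOrd.fibreIso f' i).symm
    ⟨FinOrd.toFun g (FinOrd.fibreIso f i x).1, by
      have := (FinOrd.fibreIso f i x).2
      subst h
      exact this⟩
  monotone' x y hxy := by
    apply (FinOrd.fibreIso f' i).symm.monotone
    exact (FinOrd.toFun g).monotone ((FinOrd.fibreIso f i).monotone hxy)

theorem FinOrd.fibreMap_id {a b : FinOrd} (g : a ⟶ a) (f : a ⟶ b) (h : g ≫ f = f)
    (i : Fin b.card) (hg : g = 𝟙 a) : FinOrd.fibreMap g f f h i = 𝟙 _ := by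
  subst hg
  apply OrderHom.ext
  funext x
  exact (FinOrd.fibreIso f i).symm_apply_apply x

theorem FinOrd.fibreMap_comp {a a' a'' b : FinOrd} (g : a ⟶ a') (g' : a' ⟶ a'') (k : a ⟶ a'')
    (f : a ⟶ b) (f' : a' ⟶ b) (f'' : a'' ⟶ b) (h : g ≫ f' = f) (h' : g' ≫ f'' = f')
    (h'' : k ≫ f'' = f) (i : Fin b.card) (hk : k = g ≫ g') :
    FinOrd.fibreMap k f f'' h'' i = FinOrd.fibreMap g f f' h i ≫ FinOrd.fibreMap g' f' f'' h' i := by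
  subst hk
  apply OrderHom.ext
  funext x
  change (FinOrd.fibreIso f'' i).symm _ = (FinOrd.fibreIso f'' i).symm
    ⟨FinOrd.toFun g' ((FinOrd.fibreIso f' i) ((FinOrd.fibreIso f' i).symm _)).1, _⟩
  congr 1
  apply Subtype.ext
  simp only [OrderIso.apply_symm_apply]
  rfl

/-- The presheaf `S|ᵢ` for an initial state `i ∈ S(id)`: it sends a view `V` to the fibre over `i`
of the map `S(V) ⟶ S(id)` induced by the inclusion of the identity view into `V`. -/
noncomputable def restrict {n : ℕ} (S : OPsh (View n))
    (i : Fin (S.obj (.op (View.idView n))).card) : OPsh (View n) where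
  obj V := FinOrd.fibre (S.map (View.fromId V.unop).op) i
  map {V W} g := FinOrd.fibreMap (S.map g) _ _ (by
    rw [← S.map_comp]
    congr 1
    exact congrArg Quiver.Hom.op (View.fromId_comp g.unop)) i
  map_id V := FinOrd.fibreMap_id _ _ _ i (S.map_id V)
  map_comp f g := FinOrd.fibreMap_comp _ _ _ _ _ _ _ _ _ i (S.map_comp f g)

/-! ## The endofunctor and the coalgebra of strategies -/

/-- The endofunctor `𝔽` on families of sets indexed by `ℕ` (the set of finite ordinals):
`(𝔽 X)_n = Σ_I (∏_{M ∈ 𝓜_n} X_{cod M})^I`, where `𝓜_n` is the set of basic moves from `[n]`. -/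
def strategyFunctor : (ℕ → Type) ⥤ (ℕ → Type) where
  obj X n := Σ I : ℕ, (Fin I → ∀ M : BasicMove n, X M.cod)
  map f n := ↾ fun p => ⟨p.1, fun i M => f M.cod (p.2 i M)⟩

/-- The family `ob(OPsh 𝕍_n)` as an `𝔽`-coalgebra, by temporal decomposition: a presheaf of finite
ordinals `S` on `𝕍_n` is sent to the finite word, indexed by its ordinal `S(id)` of initial
states, whose `i`-th letter maps each basic move `M` to what remains of `S` from `i` after `M`,
i.e. the presheaf `V ↦ S|ᵢ(V ∘ M)`. -/
noncomputable def strategyCoalgebra : Endofunctor.Coalgebra strategyFunctor where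
  V n := OPsh (View n)
  str n := ↾ fun S =>
    ⟨(S.obj (.op (View.idView n))).card, fun i M => M.precomp.op ⋙ restrict S i⟩

end CCSGame

namespace CCSGame

/-! ## Elements of pushouts of diagrams -/

/-! In a composite of basic moves every player plays at most one move (`MoveSeq.deterministic`).
Hence a morphism of views on `[n]` is unique if it exists, and it exists exactly when the first move
sequence is a prefix of the second (`View.exists_hom_of_cons_hom`): `𝕍ₙ` is a tree of move
sequences.

A presheaf `S` on this tree can be read as a nondeterministic strategy. A state over `w` is coded by
its list of choices: its initial state `i`, then its initial state in the residual of `S` after `i`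
and the first move, and so on. Restriction truncates these lists (`choices_map`), and the order on
states is the lexicographic one (`choices_strictMono`). Objects of `FinOrd` are mere numbers, so `S`
is determined, up to equality, by its sets of lists (`OPsh.ext_of_label`).

An element `x` of a coalgebra yields such sets of lists by running the coalgebra along `w`
(`states`). They form the presheaf `unfolding X x`, whose residuals are again unfoldings
(`residual_unfolding`), so unfolding is a coalgebra morphism. Any coalgebra morphism must produce
the same lists (`range_choices`), which gives uniqueness. -/

theorem isPushout_app {A B C : Diagram} (f : A ⟶ B) (g : A ⟶ C) (v : Vertex) :
    IsPushout (f.app (.op v.toBase)) (g.app (.op v.toBase))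
      ((pushout.inl f g).app (.op v.toBase)) ((pushout.inr f g).app (.op v.toBase)) :=
  (IsPushout.of_hasPushout f g).map ((evaluation Baseᵒᵖ Type).obj (.op v.toBase))

/-- A morphism from a representable diagram to a pushout factors through one of its summands. -/
theorem factors_pushout {A B C : Diagram} (f : A ⟶ B) (g : A ⟶ C) {v : Vertex}
    (h : v.diag ⟶ pushout f g) :
    (∃ k : v.diag ⟶ B, k ≫ pushout.inl f g = h) ∨
      ∃ k : v.diag ⟶ C, k ≫ pushout.inr f g = h := by
  rcases Types.eq_or_eq_of_isPushout (isPushout_app f g v) (yonedaEquiv h) with ⟨x, hx⟩ | ⟨x, hx⟩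
  · refine Or.inl ⟨yonedaEquiv.symm x, ?_⟩
    rw [yonedaEquiv_symm_naturality_right, hx, Equiv.symm_apply_apply]
  · refine Or.inr ⟨yonedaEquiv.symm x, ?_⟩
    rw [yonedaEquiv_symm_naturality_right, hx, Equiv.symm_apply_apply]

/-- A pushout of sets along an injection identifies only the two images of a common element.
Injectivity is asked at `v` alone: the applications take `v` a player, where it is immediate for the
final leg of a move. -/
theorem exists_of_comp_inl_eq_comp_inr {A B C : Diagram} (f : A ⟶ B) (g : A ⟶ C) {v : Vertex}
    (hf : Function.Injective (f.app (.op v.toBase))) {a : v.diag ⟶ B} {b : v.diag ⟶ C}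
    (h : a ≫ pushout.inl f g = b ≫ pushout.inr f g) :
    ∃ c : v.diag ⟶ A, c ≫ f = a ∧ c ≫ g = b := by
  obtain ⟨s, hs, hs'⟩ := (Types.pushoutCocone_inl_eq_inr_iff_of_isColimit
    (isPushout_app f g v).isColimit hf (yonedaEquiv a) (yonedaEquiv b)).1
    (congrArg yonedaEquiv h)
  refine ⟨yonedaEquiv.symm s, ?_, ?_⟩
  · rw [yonedaEquiv_symm_naturality_right, hs, Equiv.symm_apply_apply]
  · rw [yonedaEquiv_symm_naturality_right, hs', Equiv.symm_apply_apply]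

theorem comp_inr_injective {A B C : Diagram} (f : A ⟶ B) (g : A ⟶ C) {v : Vertex}
    (hf : Function.Injective (f.app (.op v.toBase))) {b b' : v.diag ⟶ C}
    (h : b ≫ pushout.inr f g = b' ≫ pushout.inr f g) : b = b' :=
  yonedaEquiv.injective (Types.pushoutCocone_inr_injective_of_isColimit
    (isPushout_app f g v).isColimit hf (congrArg yonedaEquiv h))

/-! ## Elements of basic moves -/

/-- All players have the same dimension, so a morphism between two of them is an identity; the
domain of this map has at most one element. -/
theorem BasicMove.tgt_app_injective {n : ℕ} (M : BasicMove n) (m : ℕ) :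
    Function.Injective (M.tgt.app (.op (Vertex.player m).toBase)) := by
  intro (x : (Vertex.player m).toBase ⟶ (Vertex.player M.cod).toBase) y _
  obtain ⟨_, hx⟩ := eq_of_dim_eq x rfl
  obtain ⟨_, hy⟩ := eq_of_dim_eq y rfl
  exact hx.trans hy.symm

theorem isEmpty_basic_hom_pos {n m : ℕ} (M : BasicMove n) :
    IsEmpty ((Vertex.basic M).diag ⟶ pos m) :=
  ⟨fun f => absurd (dim_le (yoneda.preimage f)) (by simp [Vertex.dim])⟩

theorem BasicMove.sigma_eq_of_hom {n m : ℕ} {N : BasicMove m} {M : BasicMove n}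
    (f : (Vertex.basic N).diag ⟶ (Vertex.basic M).diag) :
    ∃ h : m = n, h ▸ N = M ∧ HEq f (𝟙 (Vertex.basic M).diag) := by
  obtain ⟨e, he⟩ := eq_of_dim_eq (yoneda.preimage f) rfl
  have hf := congrArg yoneda.map he
  rw [yoneda.map_preimage] at hf
  obtain ⟨rfl, h⟩ := Vertex.basic.inj e
  obtain rfl := eq_of_heq h
  refine ⟨rfl, rfl, heq_of_eq (hf.trans (yoneda.map_id _))⟩

/-- An action of the edges on booleans telling the two legs of a basic move apart. -/
def Edge.legs : {a b : Vertex} → Edge a b → Bool → Bool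
  | _, _, .d _ _ => fun _ => true
  | _, _, .t _ => fun _ => true
  | _, _, .s _ => id
  | _, _, .l _ => id
  | _, _, .r _ => id
  | _, _, .ε _ _ _ _ => id
  | _, _, .ρ _ _ _ _ => id

/-- A functor telling the two legs of a basic move apart. -/
def legs : Base ⥤ Type :=
  CategoryTheory.Quotient.lift Rel
    (Paths.lift (V := Vertex) { obj := fun _ => Bool, map := fun e => ↾ (Edge.legs e) })
    (by
      -- Since `t` is constant, `s ∘ dᵢ = t ∘ dᵢ` forces `d` to be constant with the same value. The
      -- fork relation then compares identities, and the sync relation compares constants.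
      rintro _ _ _ _ (_ | _ | _) <;>
        simp [free] <;> rfl)

theorem legs_map {a b : Vertex} (e : Edge a b) : legs.map e.toBase = ↾ e.legs :=
  (CategoryTheory.Quotient.lift_map_functor_map _ _ _ _).trans (Paths.lift_toPath _ _)

/-- Under `legs`, `t` is constantly `true` and `s` is the identity, so the two sides differ at
`false`. -/
theorem BasicMove.comp_tgt_ne_src {n : ℕ} (M : BasicMove n) (c : pos n ⟶ pos M.cod) :
    c ≫ M.tgt ≠ M.src := by
  intro h
  have h' : yoneda.preimage c ≫ (Edge.t M).toBase = (Edge.s M).toBase := by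
    apply yoneda.map_injective
    rw [yoneda.map_comp, yoneda.map_preimage]
    exact h
  have h₂ := ConcreteCategory.congr_hom (congrArg legs.map h') false
  rw [legs.map_comp, legs_map, legs_map] at h₂
  exact Bool.noConfusion h₂

/-! ## Determinacy of views -/

/-- In a deterministic diagram, each player plays at most one basic move. -/
def Deterministic (P : Diagram) : Prop :=
  ∀ ⦃m : ℕ⦄ (x y : Σ N : BasicMove m, (Vertex.basic N).diag ⟶ P),
    x.1.src ≫ x.2 = y.1.src ≫ y.2 → x = y

/-- A move of the composite is either `M` itself or lies in `w`, where induction applies because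
players of `w` inject into the pushout. The mixed case (`key`) is impossible: a player shared by
both summands comes from the final leg of `M`, and the initial player of `M` does not. -/
theorem MoveSeq.deterministic : {n : ℕ} → (w : MoveSeq n) → Deterministic w.diag
  | _, .nil _ => fun _ x _ _ => ((isEmpty_basic_hom_pos x.1).false x.2).elim
  | _, .cons M w => by
    have key : ∀ {m : ℕ} (N N' : BasicMove m) (k : (Vertex.basic N).diag ⟶ (Vertex.basic M).diag)
        (k' : (Vertex.basic N').diag ⟶ w.diag),
        N.src ≫ k ≫ pushout.inl M.tgt w.incl ≠ N'.src ≫ k' ≫ pushout.inr M.tgt w.incl := by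
      intro m N N' k k' h
      obtain ⟨rfl, h₁, h₂⟩ := BasicMove.sigma_eq_of_hom k
      change N = M at h₁
      subst h₁
      obtain rfl := eq_of_heq h₂
      obtain ⟨c, hc, -⟩ := exists_of_comp_inl_eq_comp_inr N.tgt w.incl (N.tgt_app_injective m)
        (a := N.src) (b := N'.src ≫ k') (by simpa using h)
      exact N.comp_tgt_ne_src c hc
    rintro m ⟨N, x⟩ ⟨N', y⟩ h
    change N.src ≫ x = N'.src ≫ y at h
    change (Vertex.basic N).diag ⟶ pushout M.tgt w.incl at x
    change (Vertex.basic N').diag ⟶ pushout M.tgt w.incl at y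
    rcases factors_pushout _ _ x with ⟨k, rfl⟩ | ⟨k, rfl⟩ <;>
      rcases factors_pushout _ _ y with ⟨k', rfl⟩ | ⟨k', rfl⟩
    · obtain ⟨rfl, h₁, h₂⟩ := BasicMove.sigma_eq_of_hom k
      change N = M at h₁
      subst h₁
      obtain ⟨_, h₁, h₃⟩ := BasicMove.sigma_eq_of_hom k'
      change N' = N at h₁
      subst h₁
      obtain rfl := eq_of_heq h₂
      obtain rfl := eq_of_heq h₃
      rfl
    · exact (key _ _ _ _ h).elim
    · exact (key _ _ _ _ h.symm).elim
    · have h' := MoveSeq.deterministic w ⟨N, k⟩ ⟨N', k'⟩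
        (comp_inr_injective _ _ (M.tgt_app_injective m)
          ((Category.assoc _ _ _).trans (h.trans (Category.assoc _ _ _).symm)))
      cases h'
      rfl

/-- By determinacy the image of the initial player fixes the image of the first move, hence of its
final player, from which the rest of the sequence starts. -/
theorem MoveSeq.hom_ext_of_deterministic {P : Diagram} (hP : Deterministic P) :
    {n : ℕ} → (w : MoveSeq n) → (f g : w.diag ⟶ P) → w.incl ≫ f = w.incl ≫ g → f = g
  | _, .nil n, f, g, h => by
    have h' : 𝟙 (pos n) ≫ f = 𝟙 (pos n) ≫ g := h
    exact (Category.id_comp f).symm.trans (h'.trans (Category.id_comp g))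
  | _, .cons M w, f, g, h => by
    have h₁ : M.src ≫ pushout.inl M.tgt w.incl ≫ f = M.src ≫ pushout.inl M.tgt w.incl ≫ g :=
      (Category.assoc _ _ _).symm.trans (h.trans (Category.assoc _ _ _))
    have h₂ := hP ⟨M, pushout.inl M.tgt w.incl ≫ f⟩ ⟨M, pushout.inl M.tgt w.incl ≫ g⟩ h₁
    have h₃ : pushout.inl M.tgt w.incl ≫ f = pushout.inl M.tgt w.incl ≫ g := by
      simpa using h₂
    refine pushout.hom_ext h₃ (MoveSeq.hom_ext_of_deterministic hP w _ _ ?_)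
    exact (pushout.condition_assoc _).symm.trans
      ((congrArg (M.tgt ≫ ·) h₃).trans (pushout.condition_assoc _))

/-! ### Morphisms of views as prefix inclusions -/

instance {n : ℕ} (w w' : View n) : Subsingleton (w ⟶ w') :=
  ⟨fun f g => View.hom_ext (MoveSeq.hom_ext_of_deterministic (MoveSeq.deterministic w') w _ _
    ((View.incl_diagMap f).trans (View.incl_diagMap g).symm))⟩

/-- A map from a view to the composite of `M` and `w` lands in `w` as soon as its initial player
does. -/
theorem MoveSeq.exists_factor_inr {n : ℕ} (M : BasicMove n) (w : MoveSeq M.cod) :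
    {m : ℕ} → (v : MoveSeq m) → (p : pos m ⟶ w.diag) → (g : v.diag ⟶ pushout M.tgt w.incl) →
      v.incl ≫ g = p ≫ pushout.inr M.tgt w.incl → ∃ k : v.diag ⟶ w.diag, v.incl ≫ k = p
  | _, .nil _, p, _, _ => ⟨p, Category.id_comp p⟩
  | m, .cons N v, p, g, h => by
    have h₁ : N.src ≫ pushout.inl N.tgt v.incl ≫ g = p ≫ pushout.inr M.tgt w.incl :=
      (Category.assoc _ _ _).symm.trans h
    rcases factors_pushout _ _ (pushout.inl N.tgt v.incl ≫ g) with ⟨y, hy⟩ | ⟨y, hy⟩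
    -- If the first move landed in the copy of `M`, the initial player of `M` would also lie in `w`.
    · exfalso
      rw [← hy] at h₁
      obtain ⟨rfl, h₂, h₃⟩ := BasicMove.sigma_eq_of_hom y
      change N = M at h₂
      subst h₂
      obtain rfl := eq_of_heq h₃
      obtain ⟨c, hc, -⟩ := exists_of_comp_inl_eq_comp_inr N.tgt w.incl (N.tgt_app_injective m)
        (a := N.src) (b := p) (by simpa using h₁)
      exact N.comp_tgt_ne_src c hc
    · rw [← hy] at h₁
      have h₂ : N.src ≫ y = p :=
        comp_inr_injective _ _ (M.tgt_app_injective m) (by simpa using h₁)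
      obtain ⟨k, hk⟩ := MoveSeq.exists_factor_inr M w v (N.tgt ≫ y)
        (pushout.inr N.tgt v.incl ≫ g)
        ((pushout.condition_assoc _).symm.trans
          ((congrArg (N.tgt ≫ ·) hy.symm).trans (Category.assoc _ _ _).symm))
      refine ⟨pushout.desc y k hk.symm, ?_⟩
      change (N.src ≫ pushout.inl N.tgt v.incl) ≫ pushout.desc y k hk.symm = p
      rw [Category.assoc, pushout.inl_desc, h₂]

theorem View.isEmpty_cons_hom_idView {n : ℕ} (M : BasicMove n) (w : View M.cod) :
    IsEmpty ((M.precomp.obj w : View n) ⟶ View.idView n) :=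
  ⟨fun f => (isEmpty_basic_hom_pos M).false (pushout.inl M.tgt (MoveSeq.incl w) ≫ View.diagMap f)⟩

/-- Both first moves are played by the same player of the target, so determinacy identifies them.
The final player of the move then lands in `w'`, and the remaining moves follow by
`MoveSeq.exists_factor_inr`. -/
theorem View.exists_hom_of_cons_hom {n : ℕ} {M M' : BasicMove n} {w : View M.cod}
    {w' : View M'.cod} (f : (M.precomp.obj w : View n) ⟶ M'.precomp.obj w') :
    ∃ h : M = M', Nonempty ((h ▸ w : View M'.cod) ⟶ w') := by
  have h₁ : (M.src ≫ pushout.inl M.tgt (MoveSeq.incl w)) ≫ View.diagMap f =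
    M'.src ≫ pushout.inl M'.tgt (MoveSeq.incl w') := View.incl_diagMap f
  have h₂ := MoveSeq.deterministic (MoveSeq.cons M' w')
    ⟨M, pushout.inl M.tgt (MoveSeq.incl w) ≫ View.diagMap f⟩
    ⟨M', pushout.inl M'.tgt (MoveSeq.incl w')⟩ ((Category.assoc _ _ _).symm.trans h₁)
  obtain ⟨rfl, h₃⟩ := Sigma.mk.inj h₂
  have h₄ := eq_of_heq h₃
  obtain ⟨k, hk⟩ := MoveSeq.exists_factor_inr M w' w (MoveSeq.incl w')
    (pushout.inr M.tgt (MoveSeq.incl w) ≫ View.diagMap f)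
    ((pushout.condition_assoc _).symm.trans
      ((congrArg (M.tgt ≫ ·) h₄).trans pushout.condition))
  exact ⟨rfl, ⟨View.homMk k hk⟩⟩

/-! ## Labellings of presheaves of finite ordinals -/

/-- A presheaf of finite ordinals is determined by a strictly monotone labelling of its elements,
up to the set of labels and the action of restriction on them. -/
theorem OPsh.ext_of_label {K : Type} [Category.{0} K] {L : Type*} [LinearOrder L] {S T : OPsh K}
    (e : ∀ V, Fin (S.obj V).card → L) (e' : ∀ V, Fin (T.obj V).card → L)
    (he : ∀ V, StrictMono (e V)) (he' : ∀ V, StrictMono (e' V))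
    (hr : ∀ V, Set.range (e V) = Set.range (e' V)) (r : Kᵒᵖ → Kᵒᵖ → L → L)
    (hS : ∀ V W (g : V ⟶ W) s, e W (FinOrd.toFun (S.map g) s) = r V W (e V s))
    (hT : ∀ V W (g : V ⟶ W) s, e' W (FinOrd.toFun (T.map g) s) = r V W (e' V s)) : S = T := by
  have hobj : S.obj = T.obj := by
    funext V
    have h₁ := Set.ncard_range_of_injective (he V).injective
    have h₂ := Set.ncard_range_of_injective (he' V).injective
    rw [hr, h₂, Nat.card_fin, Nat.card_fin] at h₁
    exact congrArg FinOrd.mk h₁.symm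
  rcases S with ⟨So, Sm, Si, Sc⟩
  rcases T with ⟨To, Tm, Ti, Tc⟩
  obtain rfl : So = To := hobj
  -- A strictly monotone map out of a finite ordinal is determined by its range.
  obtain rfl : e = e' := funext fun V => ((he V).range_inj (he' V)).1 (hr V)
  refine Functor.hext (fun _ => rfl) fun V W g => heq_of_eq ?_
  apply OrderHom.ext
  funext s
  exact (he W).injective ((hS V W g s).trans (hT V W g s).symm)

/-- For the lexicographic order; this makes the restriction maps of an unfolding monotone. -/
theorem List.take_mono {α : Type*} [LinearOrder α] (k : ℕ) :
    Monotone (List.take k : List α → List α) := by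
  induction k with
  | zero => intro l l' _; simp
  | succ k ih =>
    intro l l' h
    cases l with
    | nil => exact not_lt.1 (List.not_lt_nil _)
    | cons a l =>
      cases l' with
      | nil => exact absurd (List.nil_lt_cons a l) h.not_gt
      | cons b l' =>
        rcases h.lt_or_eq with h | h
        · rcases List.cons_lt_cons_iff.1 h with h | ⟨rfl, hl⟩
          · exact (List.cons_lt_cons_iff.2 (.inl h)).le
          · refine not_lt.1 fun h' => (ih hl.le).not_gt ?_
            exact (List.lex_cons_iff (r := (· < ·)) (a := a) (l₁ := l'.take k) (l₂ := l.take k)).1 h'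
        · rw [h]

/-! ### States as sequences of choices -/

/-- Number of moves in a sequence. -/
def MoveSeq.length : {n : ℕ} → MoveSeq n → ℕ
  | _, .nil _ => 0
  | _, .cons _ w => w.length + 1

/-- Restriction of states of `S|ᵢ` is restriction of states of `S`. -/
theorem restrict_map_val {n : ℕ} (S : OPsh (View n)) (i : Fin (S.obj (.op (View.idView n))).card)
    {V W : (View n)ᵒᵖ} (g : V ⟶ W) (x : Fin ((restrict S i).obj V).card) :
    (FinOrd.fibreIso (S.map (View.fromId W.unop).op) i
      (FinOrd.toFun ((restrict S i).map g) x)).1 =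
    FinOrd.toFun (S.map g) (FinOrd.fibreIso (S.map (View.fromId V.unop).op) i x).1 :=
  congrArg Subtype.val ((FinOrd.fibreIso (S.map (View.fromId W.unop).op) i).apply_symm_apply _)

/-- What remains of `S` from the initial state `i` after the basic move `M`. -/
noncomputable abbrev residual {n : ℕ} (S : OPsh (View n))
    (i : Fin (S.obj (.op (View.idView n))).card) (M : BasicMove n) : OPsh (View M.cod) :=
  M.precomp.op ⋙ restrict S i

/-- The initial state below a state. -/
noncomputable def initialState {n : ℕ} (S : OPsh (View n)) (w : View n)
    (s : Fin (S.obj (.op w)).card) : Fin (S.obj (.op (View.idView n))).card :=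
  FinOrd.toFun (S.map (View.fromId w).op) s

theorem initialState_map {n : ℕ} (S : OPsh (View n)) {v w : View n} (g : v ⟶ w)
    (s : Fin (S.obj (.op w)).card) :
    initialState S v (FinOrd.toFun (S.map g.op) s) = initialState S w s := by
  unfold initialState
  rw [← View.fromId_comp g, op_comp, S.map_comp]
  rfl

/-- The state over `w` of the residual of `S` given by a state of `S` over `w ∘ M`. -/
noncomputable def residualState {n : ℕ} (S : OPsh (View n)) (M : BasicMove n) (w : View M.cod)
    (s : Fin (S.obj (.op (M.precomp.obj w))).card)
    (i : Fin (S.obj (.op (View.idView n))).card) (h : initialState S (M.precomp.obj w) s = i) :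
    Fin ((residual S i M).obj (.op w)).card :=
  (FinOrd.fibreIso (S.map (View.fromId (M.precomp.obj w)).op) i).symm ⟨s, h⟩

theorem residualState_surjective {n : ℕ} (S : OPsh (View n)) (M : BasicMove n) (w : View M.cod)
    (i : Fin (S.obj (.op (View.idView n))).card) (x : Fin ((residual S i M).obj (.op w)).card) :
    ∃ s h, residualState S M w s i h = x := by
  let y := FinOrd.fibreIso (S.map (View.fromId (M.precomp.obj w)).op) i x
  exact ⟨y.1, y.2, OrderIso.symm_apply_apply _ _⟩

/-- The sequence of choices made by a state: its initial state, the initial state in the residual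
after the first move, and so on. -/
noncomputable def choices : {n : ℕ} → (S : OPsh (View n)) → (w : MoveSeq n) →
    Fin (S.obj (.op (w : View n))).card → List ℕ
  | _, _, .nil _, s => [s.val]
  | _, S, .cons M w, s =>
    (initialState S (.cons M w) s).val ::
      choices (residual S (initialState S (.cons M w) s) M) w (residualState S M w s _ rfl)

/-- The free index `i` lets two states with propositionally equal initial states be compared inside
one residual. -/
theorem choices_cons {n : ℕ} (S : OPsh (View n)) (M : BasicMove n) (w : MoveSeq M.cod)
    (s : Fin (S.obj (.op (M.precomp.obj w))).card)
    (i : Fin (S.obj (.op (View.idView n))).card) (h : initialState S (M.precomp.obj w) s = i) :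
    choices S (.cons M w) s = i.val :: choices (residual S i M) w (residualState S M w s i h) := by
  subst h
  rfl

/-- Restriction to the identity view is monotone, so the heads are weakly ordered. If they agree,
both states lie in one fibre, with its induced order, and induction compares the tails. -/
theorem choices_strictMono : {n : ℕ} → (S : OPsh (View n)) → (w : MoveSeq n) →
    StrictMono (choices S w)
  | _, _, .nil _ => fun s s' h => by
    simpa [choices, List.cons_lt_cons_iff] using h
  | _, S, .cons M w => fun s s' h => by
    have hm : initialState S (.cons M w) s ≤ initialState S (.cons M w) s' :=
      (FinOrd.toFun (S.map (View.fromId _).op)).monotone h.le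
    rw [choices_cons S M w s _ rfl]
    rcases hm.lt_or_eq with hlt | heq
    · rw [choices_cons S M w s' _ rfl]
      exact List.cons_lt_cons_iff.2 (.inl hlt)
    · rw [choices_cons S M w s' _ heq.symm]
      refine List.cons_lt_cons_iff.2 (.inr ⟨rfl, choices_strictMono _ w ?_⟩)
      exact (FinOrd.fibreIso _ _).symm.strictMono h

theorem take_one_choices {n : ℕ} (S : OPsh (View n)) (w : MoveSeq n)
    (s : Fin (S.obj (.op (w : View n))).card) :
    (choices S w s).take 1 = [(initialState S w s).val] := by
  cases w with
  | nil =>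
    have : View.fromId (View.idView n) = 𝟙 _ := Subsingleton.elim _ _
    have h : initialState S (View.idView n) s = s := by
      unfold initialState
      rw [this, op_id, S.map_id]
      rfl
    rw [show initialState S (MoveSeq.nil n) s = s from h]
    rfl
  | cons M w => rw [choices_cons S M w s _ rfl]; rfl

/-- The `+ 1` is the initial choice: a state over `k` moves carries `k + 1` choices. -/
theorem choices_map {n : ℕ} (S : OPsh (View n)) (v w : View n) (g : v ⟶ w)
    (s : Fin (S.obj (.op w)).card) :
    choices S v (FinOrd.toFun (S.map g.op) s) =
      (choices S w s).take (MoveSeq.length v + 1) := by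
  change MoveSeq n at v
  induction v with
  | nil n =>
    obtain rfl : g = View.fromId w := Subsingleton.elim _ _
    exact (take_one_choices S w s).symm
  | @cons n M v ih =>
    cases w with
    | nil => exact ((View.isEmpty_cons_hom_idView M v).false g).elim
    | cons M' w =>
      obtain ⟨rfl, ⟨g'⟩⟩ := View.exists_hom_of_cons_hom g
      change @Quiver.Hom (View M.cod) _ v w at g'
      -- Morphisms of views being unique, `g` may be taken in the image of `- ∘ M`, so that it acts
      -- on residuals.
      obtain rfl : g = M.precomp.map g' := Subsingleton.elim _ _
      refine (choices_cons S M v _ _ (initialState_map S (M.precomp.map g') s)).trans ?_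
      refine Eq.trans (congrArg (_ :: ·) (Eq.trans ?_ (ih _ w _ g')))
        (congrArg (List.take (v.length + 1 + 1)) (choices_cons S M w s _ rfl)).symm
      congr 1
      apply (FinOrd.fibreIso (S.map (View.fromId (M.precomp.obj v)).op) _).injective
      apply Subtype.ext
      refine Eq.trans ?_ (restrict_map_val S _ (M.precomp.map g').op _).symm
      simp only [residualState, OrderIso.apply_symm_apply]

/-! ## Unfolding a coalgebra -/

/-- The number of initial states of an element of a coalgebra. -/
def width (X : Endofunctor.Coalgebra strategyFunctor) {n : ℕ} (x : X.V n) : ℕ :=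
  ((X.str n) x).1

/-- The element reached from an initial state by a basic move. -/
def next (X : Endofunctor.Coalgebra strategyFunctor) {n : ℕ} (x : X.V n) (i : Fin (width X x))
    (M : BasicMove n) : X.V M.cod :=
  ((X.str n) x).2 i M

/-- The possible sequences of choices along a sequence of moves. -/
def states (X : Endofunctor.Coalgebra strategyFunctor) :
    {n : ℕ} → X.V n → MoveSeq n → Finset (List ℕ)
  | _, x, .nil _ => (Finset.univ : Finset (Fin (width X x))).image fun i => [i.val]
  | _, x, .cons M w => (Finset.univ : Finset (Fin (width X x))).biUnion fun i =>
      (states X (next X x i M) w).image (i.val :: ·)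

section

variable (X : Endofunctor.Coalgebra strategyFunctor)

theorem mem_states_nil {n : ℕ} (x : X.V n) (l : List ℕ) :
    l ∈ states X x (.nil n) ↔ ∃ i : Fin (width X x), [i.val] = l := by
  simp [states]

theorem mem_states_cons {n : ℕ} (x : X.V n) (M : BasicMove n) (w : MoveSeq M.cod) (l : List ℕ) :
    l ∈ states X x (.cons M w) ↔
      ∃ (i : Fin (width X x)) (l' : List ℕ), l' ∈ states X (next X x i M) w ∧ i.val :: l' = l := by
  simp [states]

theorem take_one_mem_states {n : ℕ} (x : X.V n) (w : MoveSeq n) {l : List ℕ}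
    (hl : l ∈ states X x w) : l.take 1 ∈ states X x (.nil n) := by
  rw [mem_states_nil]
  cases w with
  | nil =>
    obtain ⟨i, rfl⟩ := (mem_states_nil X x l).1 hl
    exact ⟨i, rfl⟩
  | cons M w =>
    obtain ⟨i, l', -, rfl⟩ := (mem_states_cons X x M w l).1 hl
    exact ⟨i, rfl⟩

theorem take_mem_states {n : ℕ} (x : X.V n) (v w : View n) (g : v ⟶ w) {l : List ℕ}
    (hl : l ∈ states X x w) : l.take (MoveSeq.length v + 1) ∈ states X x v := by
  change MoveSeq n at v
  induction v generalizing l with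
  | nil n => exact take_one_mem_states X x w hl
  | @cons n M v ih =>
    cases w with
    | nil => exact ((View.isEmpty_cons_hom_idView M v).false g).elim
    | cons M' w =>
      obtain ⟨rfl, ⟨g'⟩⟩ := View.exists_hom_of_cons_hom g
      obtain ⟨i, l', hl', rfl⟩ := (mem_states_cons X x M w l).1 hl
      exact (mem_states_cons X x M v _).2 ⟨i, _, ih _ w hl' g', rfl⟩

theorem length_of_mem_states {n : ℕ} (x : X.V n) (w : MoveSeq n) {l : List ℕ}
    (hl : l ∈ states X x w) : l.length = w.length + 1 := by
  induction w generalizing l with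
  | nil n =>
    obtain ⟨i, rfl⟩ := (mem_states_nil X x l).1 hl
    rfl
  | cons M w ih =>
    obtain ⟨i, l', hl', rfl⟩ := (mem_states_cons X x M w l).1 hl
    rw [List.length_cons, ih _ hl', MoveSeq.length]

/-- The presheaf of finite ordinals unfolding an element of a coalgebra. -/
def unfolding {n : ℕ} (x : X.V n) : OPsh (View n) where
  obj V := ⟨(states X x V.unop).card⟩
  map {V W} g :=
    { toFun := fun s => ((states X x W.unop).orderIsoOfFin rfl).symm
        ⟨_, take_mem_states X x _ _ g.unop ((states X x V.unop).orderIsoOfFin rfl s).2⟩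
      monotone' := fun s s' h => ((states X x W.unop).orderIsoOfFin rfl).symm.monotone
        (List.take_mono _ (((states X x V.unop).orderIsoOfFin rfl).monotone h)) }
  map_id V := by
    apply OrderHom.ext
    funext s
    refine (OrderIso.symm_apply_eq _).2 (Subtype.ext (List.take_of_length_le ?_))
    exact (length_of_mem_states X x _ ((states X x V.unop).orderIsoOfFin rfl s).2).le
  map_comp {U V W} f g := by
    apply OrderHom.ext
    funext s
    refine (OrderIso.symm_apply_eq _).2 (Subtype.ext ?_)
    change _ = (((states X x W.unop).orderIsoOfFin rfl) (((states X x W.unop).orderIsoOfFin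
      rfl).symm ⟨List.take _ (((states X x V.unop).orderIsoOfFin rfl) (((states X x V.unop
        ).orderIsoOfFin rfl).symm _)).1, _⟩)).1
    simp only [OrderIso.apply_symm_apply, List.take_take]
    -- The doubly truncated list has exactly one entry more than `W` has moves, so `W` is no longer
    -- than `V` and the first truncation is absorbed.
    have h₁ := take_mem_states X x _ _ f.unop ((states X x U.unop).orderIsoOfFin rfl s).2
    have h₂ := length_of_mem_states X x _ (take_mem_states X x _ _ g.unop h₁)
    rw [List.take_take, List.length_take] at h₂
    congr 1
    omega

/-- The sequence of choices labelling a state of the unfolding. -/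
noncomputable def unfoldingLabel {n : ℕ} (x : X.V n) (w : View n)
    (s : Fin ((unfolding X x).obj (.op w)).card) : List ℕ :=
  (states X x w).orderEmbOfFin rfl s

theorem unfoldingLabel_strictMono {n : ℕ} (x : X.V n) (w : View n) :
    StrictMono (unfoldingLabel X x w) :=
  ((states X x w).orderEmbOfFin rfl).strictMono

theorem unfoldingLabel_mem {n : ℕ} (x : X.V n) (w : View n)
    (s : Fin ((unfolding X x).obj (.op w)).card) : unfoldingLabel X x w s ∈ states X x w :=
  Finset.orderEmbOfFin_mem _ _ _

theorem range_unfoldingLabel {n : ℕ} (x : X.V n) (w : View n) :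
    Set.range (unfoldingLabel X x w) = states X x w :=
  Finset.range_orderEmbOfFin _ _

theorem unfoldingLabel_map {n : ℕ} (x : X.V n) (v w : View n) (g : v ⟶ w)
    (s : Fin ((unfolding X x).obj (.op w)).card) :
    unfoldingLabel X x v (FinOrd.toFun ((unfolding X x).map g.op) s) =
      (unfoldingLabel X x w s).take (MoveSeq.length v + 1) :=
  congrArg Subtype.val (((states X x v).orderIsoOfFin rfl).apply_symm_apply _)

/-! ### Residuals of an unfolding -/

theorem exists_fin_congr {k m : ℕ} (h : k = m) (p : ℕ → Prop) :
    (∃ i : Fin k, p i.val) ↔ ∃ j : Fin m, p j.val := by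
  subst h
  rfl

theorem unfolding_card_idView {n : ℕ} (x : X.V n) :
    ((unfolding X x).obj (.op (View.idView n))).card = width X x := by
  refine (Finset.card_image_of_injective _ fun i j h => ?_).trans (Finset.card_fin _)
  simpa [Fin.ext_iff] using h

/-- Both sides are strictly monotone in `i` with the same range. -/
theorem unfoldingLabel_idView {n : ℕ} (x : X.V n)
    (i : Fin ((unfolding X x).obj (.op (View.idView n))).card) :
    unfoldingLabel X x (View.idView n) i = [i.val] := by
  refine congrFun (((unfoldingLabel_strictMono X x _).range_inj (g := fun i => [i.val]) ?_).1 ?_) i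
  · intro i j h
    exact List.cons_lt_cons_iff.2 (.inl h)
  · rw [range_unfoldingLabel]
    ext l
    refine (mem_states_nil X x l).trans ?_
    exact (exists_fin_congr (unfolding_card_idView X x) fun j => [j] = l).symm

/-- Restricting to the identity view keeps only the first entry of a label, so that entry is the
initial state. -/
theorem unfoldingLabel_cons {n : ℕ} (x : X.V n) (M : BasicMove n) (w : View M.cod)
    (s : Fin ((unfolding X x).obj (.op (M.precomp.obj w))).card)
    (i : Fin ((unfolding X x).obj (.op (View.idView n))).card)
    (h : initialState (unfolding X x) (M.precomp.obj w) s = i) :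
    ∃ l ∈ states X (next X x (i.cast (unfolding_card_idView X x)) M) w,
      unfoldingLabel X x (M.precomp.obj w) s = i.val :: l := by
  obtain ⟨j, l, hl, h'⟩ := (mem_states_cons X x M w _).1 (unfoldingLabel_mem X x _ s)
  have h₁ := unfoldingLabel_map X x _ _ (View.fromId (M.precomp.obj w)) s
  change unfoldingLabel X x _ (initialState (unfolding X x) (M.precomp.obj w) s) = _ at h₁
  rw [h, unfoldingLabel_idView, ← h'] at h₁
  obtain rfl : j = i.cast (unfolding_card_idView X x) := by
    apply Fin.ext
    exact (List.cons.inj h₁).1.symm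
  exact ⟨l, hl, h'.symm⟩

/-- This is the coalgebra morphism equation for `unfolding`. A residual state is labelled by the
tail of its label in the unfolding of `x`; all these labels have head `i`, so dropping it keeps them
strictly ordered. -/
theorem residual_unfolding {n : ℕ} (x : X.V n)
    (i : Fin ((unfolding X x).obj (.op (View.idView n))).card) (M : BasicMove n) :
    residual (unfolding X x) i M =
      unfolding X (next X x (i.cast (unfolding_card_idView X x)) M) := by
  let π (w : View M.cod) (y : Fin ((residual (unfolding X x) i M).obj (.op w)).card) :=
    FinOrd.fibreIso ((unfolding X x).map (View.fromId (M.precomp.obj w)).op) i y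
  have hπ : ∀ w y, ∃ l ∈ states X (next X x (i.cast (unfolding_card_idView X x)) M) w,
      unfoldingLabel X x (M.precomp.obj w) (π w y).1 = i.val :: l := fun w y =>
    unfoldingLabel_cons X x M w _ i (π w y).2
  refine OPsh.ext_of_label
    (fun V y => (unfoldingLabel X x (M.precomp.obj V.unop) (π V.unop y).1).tail)
    (fun V => unfoldingLabel X _ V.unop) ?_ (fun V => unfoldingLabel_strictMono X _ V.unop) ?_
    (fun _ W l => l.take (MoveSeq.length W.unop + 1)) ?_
    (fun V W g => unfoldingLabel_map X _ _ _ g.unop)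
  · intro V y y' h
    have h₁ := unfoldingLabel_strictMono X x (M.precomp.obj V.unop)
      (show (π V.unop y).1 < (π V.unop y').1 from (FinOrd.fibreIso _ _).strictMono h)
    obtain ⟨l, -, hl⟩ := hπ V.unop y
    obtain ⟨l', -, hl'⟩ := hπ V.unop y'
    simp only [hl, hl', List.tail_cons] at h₁ ⊢
    rcases List.cons_lt_cons_iff.1 h₁ with h₁ | h₁
    · exact absurd h₁ (lt_irrefl _)
    · exact h₁.2
  · intro V
    rw [range_unfoldingLabel]
    ext l
    constructor
    · rintro ⟨y, rfl⟩
      obtain ⟨l, hl, hy⟩ := hπ V.unop y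
      simpa only [hy, List.tail_cons, Finset.mem_coe] using hl
    · intro hl
      have h₁ : i.val :: l ∈ Set.range (unfoldingLabel X x (M.precomp.obj V.unop)) := by
        rw [range_unfoldingLabel]
        exact (mem_states_cons X x M V.unop _).2 ⟨_, l, hl, rfl⟩
      obtain ⟨s, hs⟩ := h₁
      have h₂ : initialState (unfolding X x) (M.precomp.obj V.unop) s = i := by
        obtain ⟨l', -, h'⟩ := unfoldingLabel_cons X x M V.unop s _ rfl
        exact Fin.ext (List.cons.inj (h'.symm.trans hs)).1
      refine ⟨residualState (unfolding X x) M V.unop s i h₂, ?_⟩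
      have h₃ : (π V.unop (residualState (unfolding X x) M V.unop s i h₂)).1 = s :=
        congrArg Subtype.val (OrderIso.apply_symm_apply _ _)
      simp only [h₃, hs, List.tail_cons]
  · intro V W g y
    obtain ⟨l, -, hl⟩ := hπ V.unop y
    have h₁ : (π W.unop (FinOrd.toFun ((residual (unfolding X x) i M).map g) y)).1 = _ :=
      restrict_map_val (unfolding X x) i (M.precomp.map g.unop).op y
    have h₂ := unfoldingLabel_map X x _ _ (M.precomp.map g.unop) (π V.unop y).1
    rw [hl] at h₂
    rw [h₁, hl, List.tail_cons]
    exact congrArg List.tail h₂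

/-! ## Terminality -/

/-- Used both to establish and to read off the commuting square of a coalgebra morphism without
heterogeneous equality. -/
theorem Sigma.fin_fun_eq_iff {Z : Type*} (p q : Σ I : ℕ, (Fin I → Z)) :
    p = q ↔ ∃ h : p.1 = q.1, ∀ i, p.2 i = q.2 (i.cast h) := by
  obtain ⟨I, p⟩ := p
  obtain ⟨J, q⟩ := q
  constructor
  · rintro h
    cases h
    exact ⟨rfl, fun _ => rfl⟩
  · rintro ⟨h, h'⟩
    change I = J at h
    subst h
    exact congrArg _ (funext h')

/-- Unfolding, as a morphism to the coalgebra of presheaves. -/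
noncomputable def unfoldingHom : X ⟶ strategyCoalgebra where
  f n := ↾ fun x => unfolding X x
  h := by
    funext n
    apply ConcreteCategory.hom_ext
    intro x
    refine ((Sigma.fin_fun_eq_iff _ _).2 ⟨unfolding_card_idView X x, fun i => ?_⟩).symm
    funext M
    exact residual_unfolding X x i M

/-- The hypothesis `hφ` is the coalgebra morphism square, unbundled. It turns each residual of `φ n
x` into the image of a successor of `x`, to which the induction on `w` applies. -/
theorem range_choices {φ : ∀ n, X.V n → OPsh (View n)}
    (hφ : ∀ n (x : X.V n), ∃ h : ((φ n x).obj (.op (View.idView n))).card = width X x,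
      ∀ i M, residual (φ n x) i M = φ M.cod (next X x (i.cast h) M))
    {n : ℕ} (x : X.V n) (w : MoveSeq n) : Set.range (choices (φ n x) w) = states X x w := by
  induction w with
  | nil n =>
    obtain ⟨h, -⟩ := hφ n x
    ext l
    refine Iff.trans ?_ (mem_states_nil X x l).symm
    exact exists_fin_congr h fun j => [j] = l
  | @cons n M w ih =>
    obtain ⟨h, hr⟩ := hφ n x
    have ih' : ∀ i, Set.range (choices (residual (φ n x) i M) w) =
        states X (next X x (i.cast h) M) w := fun i => by rw [hr, ih]
    ext l
    refine Iff.trans ?_ (mem_states_cons X x M w l).symm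
    constructor
    · rintro ⟨s, rfl⟩
      refine ⟨(initialState (φ n x) (M.precomp.obj w) s).cast h, _, ?_,
        (choices_cons (φ n x) M w s _ rfl).symm⟩
      exact (Set.ext_iff.1 (ih' _) _).1 ⟨_, rfl⟩
    · rintro ⟨j, l, hl, rfl⟩
      obtain ⟨y, rfl⟩ := (Set.ext_iff.1 (ih' (j.cast h.symm)) l).2 hl
      obtain ⟨s, hs, rfl⟩ := residualState_surjective _ _ _ _ y
      exact ⟨s, choices_cons _ _ _ _ _ hs⟩

theorem eq_unfolding {φ : ∀ n, X.V n → OPsh (View n)}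
    (hφ : ∀ n (x : X.V n), ∃ h : ((φ n x).obj (.op (View.idView n))).card = width X x,
      ∀ i M, residual (φ n x) i M = φ M.cod (next X x (i.cast h) M))
    {n : ℕ} (x : X.V n) : φ n x = unfolding X x :=
  OPsh.ext_of_label (fun V => choices (φ n x) V.unop) (fun V => unfoldingLabel X x V.unop)
    (fun V => choices_strictMono _ V.unop) (fun V => unfoldingLabel_strictMono X x V.unop)
    (fun V => (range_choices X hφ x V.unop).trans (range_unfoldingLabel X x V.unop).symm)
    (fun _ W l => l.take (MoveSeq.length W.unop + 1))
    (fun _ _ g => choices_map _ _ _ g.unop) (fun _ _ g => unfoldingLabel_map X _ _ _ g.unop)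

theorem eq_unfoldingHom (f : X ⟶ strategyCoalgebra) : f = unfoldingHom X := by
  apply Endofunctor.Coalgebra.Hom.ext
  funext n
  apply ConcreteCategory.hom_ext
  intro x
  refine eq_unfolding X (φ := fun n x => f.f n x) (fun n x => ?_) x
  obtain ⟨h, hr⟩ := (Sigma.fin_fun_eq_iff _ _).1
    (ConcreteCategory.congr_hom (congrFun f.h n) x).symm
  exact ⟨h, fun i M => congrFun (hr i) M⟩

end

end CCSGame

theorem mainTheorem2 :
    Nonempty (CategoryTheory.Limits.IsTerminal CCSGame.strategyCoalgebra) := by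
  exact ⟨IsTerminal.ofUniqueHom CCSGame.unfoldingHom CCSGame.eq_unfoldingHom⟩
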